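/- Let $d\ge 0$, let $\mathbf f:\mathbb R^d\to\mathbb R^d$ and $\boldsymbol\theta^*\in\mathbb R^d$; $\|\cdot\|_2$ denotes the Euclidean norm and $\|\cdot\|_S$ the spectral norm of a matrix. Let $(\alpha_t)_{t\ge 0}$ be a deterministic sequence with $\alpha_t\in(0,1)$ for all $t$. On a probability space let $\boldsymbol\theta_0$ and $\boldsymbol\xi_1,\boldsymbol\xi_2,\dots$ be $\mathbb R^d$-valued random vectors, and let $$\boldsymbol\theta_{t+1}=\boldsymbol\theta_t+\alpha_t\bigl(\mathbf f(\boldsymbol\theta_t)+\boldsymbol\xi_{t+1}\bigr),\qquad t\ge 0 .$$ Let $\mathcal F_t$ be the $\sigma$-algebra generated by $\boldsymbol\theta_0,\dots,\boldsymbol\theta_t,\boldsymbol\xi_1,\dots,\boldsymbol\xi_t$. Assume: - (F1) $\boldsymbol\theta^*$ is the unique solution of $\mathbf f(\boldsymbol\theta)=\mathbf 0$. - (F2') $\mathbf f$ is twice continuously differentiable and globally Lipschitz-continuous. - (F3) $\boldsymbol\theta^*$ is a globally exponentially stable equilibrium of the ODE $\dot{\boldsymbol\theta}=\mathbf f(\boldsymbol\theta)$: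 there are constants $\mu\ge 1$ and $\gamma>0$ such that, for every $\boldsymbol\theta\in\mathbb R^d$, the solution $\mathbf s(\cdot,\boldsymbol\theta)$ on $[0,\infty)$ with $\mathbf s(0,\boldsymbol\theta)=\boldsymbol\theta$ satisfies $\|\mathbf s(t,\boldsymbol\theta)-\boldsymbol\theta^*\|_2\le\mu\,\|\boldsymbol\theta-\boldsymbol\theta^*\|_2\,e^{-\gamma t}$ for all $t\ge 0$. - (F4) There is a finite constant $K$ such that the Hessians of the components of $\mathbf f$ satisfy $\|\nabla^2 f_i(\boldsymbol\theta)\|_S\cdot\|\boldsymbol\theta-\boldsymbol\theta^*\|_2\le K$ for all $i\in\{1,\dots,d\}$ and all $\boldsymbol\theta\in\mathbb R^d$. - (N1) For all $t\ge 0$, $\boldsymbol\xi_{t+1}$ is integrable and $E(\boldsymbol\xi_{t+1}\mid\mathcal F_t)=\mathbf 0$ almost surely. - (N2) There is a finite constant $\sigma^2\ge 0$ such that, for all $t\ge 0$, $E(\|\boldsymbol\xi_{t+1}\|_2^2\mid\mathcal F_t)\le\sigma^2\bigl(1+\|\boldsymbol\theta_t-\boldsymbol\theta^*\|_2^2\bigr)$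 almost surely. Then: 1. If $\sum_t\alpha_t^2<\infty$, then the sequence $(\boldsymbol\theta_t)_{t\ge 0}$ is bounded almost surely. 2. If $\sum_t\alpha_t^2<\infty$ and $\sum_t\alpha_t=\infty$, then $\boldsymbol\theta_t\to\boldsymbol\theta^*$ almost surely as $t\to\infty$. -/

import Mathlib

open MeasureTheory ProbabilityTheory Filter Topology
open scoped NNReal ENNReal

namespace StochApprox

/-- `θs` is the unique solution of `f θ = 0`. -/
def IsUniqueZero {d : ℕ} (f : EuclideanSpace ℝ (Fin d) → EuclideanSpace ℝ (Fin d))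
    (θs : EuclideanSpace ℝ (Fin d)) : Prop :=
  f θs = 0 ∧ ∀ θ, f θ = 0 → θ = θs

/-- `f` is twice continuously differentiable and globally Lipschitz-continuous. -/
def IsC2Lipschitz {d : ℕ} (f : EuclideanSpace ℝ (Fin d) → EuclideanSpace ℝ (Fin d)) : Prop :=
  ContDiff ℝ 2 f ∧ ∃ L : ℝ≥0, LipschitzWith L f

/-- `θs` is a globally exponentially stable equilibrium of the ODE `θ' = f θ`: there are constants
`μ ≥ 1` and `γ > 0` such that every solution `s` of the ODE on `[0, ∞)` satisfies
`‖s t - θs‖ ≤ μ * ‖s 0 - θs‖ * exp (-γ t)` for all `t ≥ 0`. -/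
def IsGloballyExpStable {d : ℕ} (f : EuclideanSpace ℝ (Fin d) → EuclideanSpace ℝ (Fin d))
    (θs : EuclideanSpace ℝ (Fin d)) : Prop :=
  f θs = 0 ∧
  ∃ μ γ : ℝ, 1 ≤ μ ∧ 0 < γ ∧
    ∀ (θ : EuclideanSpace ℝ (Fin d)) (s : ℝ → EuclideanSpace ℝ (Fin d)),
      s 0 = θ → IsIntegralCurveOn s (fun _ => f) (Set.Ici 0) →
      ∀ t : ℝ, 0 ≤ t → ‖s t - θs‖ ≤ μ * ‖θ - θs‖ * Real.exp (-γ * t)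

/-- The Hessian `∇²g` of a scalar function, as a linear operator on Euclidean space: the derivative
of the gradient. In the standard basis its matrix is the matrix of second partial derivatives, and
its operator norm is the spectral norm (largest singular value) of that matrix. -/
noncomputable def hessian {d : ℕ} (g : EuclideanSpace ℝ (Fin d) → ℝ)
    (θ : EuclideanSpace ℝ (Fin d)) :
    EuclideanSpace ℝ (Fin d) →L[ℝ] EuclideanSpace ℝ (Fin d) :=
  fderiv ℝ (gradient g) θ

/-- There is a finite `K` with `‖∇²f_i(θ)‖ * ‖θ - θs‖ ≤ K` for all components `i` and all `θ`. -/
def HasHessianDecay {d : ℕ} (f : EuclideanSpace ℝ (Fin d) → EuclideanSpace ℝ (Fin d))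
    (θs : EuclideanSpace ℝ (Fin d)) : Prop :=
  ∃ K : ℝ, ∀ (i : Fin d) (θ : EuclideanSpace ℝ (Fin d)),
    ‖hessian (fun φ => f φ i) θ‖ * ‖θ - θs‖ ≤ K

/-- The σ-algebra `F_t` generated by `θ_0, …, θ_t` and `ξ_1, …, ξ_t`. -/
@[reducible] def history {Ω : Type*} {d : ℕ} (θ ξ : ℕ → Ω → EuclideanSpace ℝ (Fin d)) (t : ℕ) :
    MeasurableSpace Ω :=
  (⨆ s ∈ Set.Icc 0 t, MeasurableSpace.comap (θ s) inferInstance) ⊔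
    (⨆ s ∈ Set.Icc 1 t, MeasurableSpace.comap (ξ s) inferInstance)

/-- `E(ξ_{t+1} | F_t) = 0` almost surely, for all `t ≥ 0`. -/
def NoiseMeanZero {Ω : Type*} [MeasurableSpace Ω] (P : Measure Ω) {d : ℕ}
    (θ ξ : ℕ → Ω → EuclideanSpace ℝ (Fin d)) : Prop :=
  ∀ t : ℕ, Integrable (ξ (t + 1)) P ∧ P[ξ (t + 1) | history θ ξ t] =ᵐ[P] 0

/-- `E(‖ξ_{t+1}‖² | F_t) ≤ σ² (1 + ‖θ_t - θs‖²)` almost surely, for all `t ≥ 0` and a finite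
constant `σ²`. The conditional expectation is that of a `[0, ∞]`-valued function, so that it is
defined without any moment assumption. -/
def NoiseVarianceBound {Ω : Type*} [MeasurableSpace Ω] (P : Measure Ω) {d : ℕ}
    (θs : EuclideanSpace ℝ (Fin d)) (θ ξ : ℕ → Ω → EuclideanSpace ℝ (Fin d)) : Prop :=
  ∃ σ : ℝ, ∀ t : ℕ, P⁻[fun ω => ‖ξ (t + 1) ω‖ₑ ^ 2 | history θ ξ t] ≤ᵐ[P]
    fun ω => ENNReal.ofReal (σ ^ 2 * (1 + ‖θ t ω - θs‖ ^ 2))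

/-- `θ_{t+1} = θ_t + α_t (f(θ_t) + ξ_{t+1})`, for all `t ≥ 0`. -/
def IsSARecursion {Ω : Type*} {d : ℕ} (f : EuclideanSpace ℝ (Fin d) → EuclideanSpace ℝ (Fin d))
    (α : ℕ → ℝ) (θ ξ : ℕ → Ω → EuclideanSpace ℝ (Fin d)) : Prop :=
  ∀ (t : ℕ) (ω : Ω), θ (t + 1) ω = θ t ω + α t • (f (θ t ω) + ξ (t + 1) ω)

end StochApprox

/-! The proof compares the process with the ODE flow over blocks whose total step size is bounded.
The flow contracts over long blocks, which gives a mean square bound once the process is localized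
on events where the initial value is bounded; hence the accumulated noise is an `L²`-bounded
martingale and converges, and the conclusion follows pathwise. The decay of the Hessians is not
needed for this argument. -/

/-! Let `M t` be the accumulated noise, the sum of the `α k • ξ (k + 1)` with `k < t`. If `M`
converges to `c` along a path, then `θ t + (c - M t)` is an Euler scheme for `f` whose perturbation
tends to zero. Over a block of total step size in `[T, T + 1]`, with small steps, an Euler scheme
stays close to the exponentially stable flow and halves its distance to `θs` up to the perturbation
(`exists_euler_contraction`). Iterating over blocks gives convergence (`tendsto_of_tendsto_noise`).
If the steps are summable, Grönwall's inequality already bounds the path.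

It remains to show that `M` converges. Its increments are orthogonal with variance at most `α t ^ 2
* σ ^ 2 * (1 + u t)`, where `u t` is the mean square distance of `θ t` to `θs`, so a bound on `u`
makes `M` an `L²`-bounded martingale. To bound `u`, each block is compared with the noiseless Euler
scheme from the same starting point: the scheme contracts, and the mean square difference is a
multiple of the sum of `α t ^ 2` over the block, hence small for late blocks (`exists_block_sq_le`).

The initial value need not be square integrable. The events on which `‖θ 0 - θs‖ ≤ k` are known at
time 0, so freezing the process at `θs` off such an event preserves the assumptions; these events
exhaust the space. -/

namespace StochApprox

/-! ### Flow, Grönwall's inequality and Euler schemes -/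

section Deterministic

variable {E : Type*} [NormedAddCommGroup E] [NormedSpace ℝ E]

/-- A globally Lipschitz `C¹` vector field has a global integral curve through every point. -/
theorem exists_global_integralCurve [CompleteSpace E] {f : E → E} {L : ℝ≥0}
    (hf : ContDiff ℝ 1 f) (hL : LipschitzWith L f) (x : E) :
    ∃ s : ℝ → E, s 0 = x ∧ ∀ t, HasDerivAt s (f (s t)) t := by
  -- On the ball of radius `‖f y‖ + 1` about `y` the field is bounded by `(1 + L) * (‖f y‖ + 1)`, so
  -- the existence time `1 / (1 + L)` does not depend on `y`. This uniformity makes the local curves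
  -- extend globally.
  have hε : (0 : ℝ) < 1 / (1 + L) := by positivity
  have key := exists_isMIntegralCurve_of_isMIntegralCurveOn (I := modelWithCornersSelf ℝ E) (M := E)
    (v := f) (contMDiff_vectorSpace_iff_contDiff.2 hf) hε ?_ x
  · obtain ⟨s, hs0, hs⟩ := key
    refine ⟨s, hs0, fun t => ?_⟩
    have h : HasFDerivAt s ((1 : ℝ →L[ℝ] ℝ).smulRight (f (s t))) t :=
      hasMFDerivAt_iff_hasFDerivAt.1 (hs t)
    simpa using h.hasDerivAt
  intro y
  have h0 : (0 : ℝ) ∈ Set.Icc (-(1 / (1 + L) : ℝ)) (1 / (1 + L)) := ⟨by linarith, hε.le⟩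
  have hpl : IsPicardLindelof (fun _ => f) (⟨0, h0⟩ : Set.Icc (-(1 / (1 + L) : ℝ)) (1 / (1 + L)))
      y (‖f y‖₊ + 1) 0 ((1 + L) * (‖f y‖₊ + 1)) L := by
    refine ⟨fun t _ => hL.lipschitzOnWith, fun _ _ => continuousOn_const, fun t _ z hz => ?_, ?_⟩
    · have h1 : ‖f z - f y‖ ≤ L * ‖z - y‖ := by simpa [dist_eq_norm] using hL.dist_le_mul z y
      have h2 : ‖z - y‖ ≤ ‖f y‖ + 1 := by simpa [dist_eq_norm] using hz
      have h3 : ‖f z‖ ≤ ‖f z - f y‖ + ‖f y‖ := by simpa using norm_add_le (f z - f y) (f y)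
      have h4 : L * ‖z - y‖ ≤ L * (‖f y‖ + 1) := by gcongr
      push_cast
      nlinarith
    · simp only [sub_zero, zero_sub, neg_neg, max_self]
      push_cast
      simp only [sub_zero]
      have : (0 : ℝ) < 1 + L := by positivity
      apply le_of_eq
      field_simp
  obtain ⟨s, hs0, hs⟩ := hpl.exists_eq_forall_mem_Icc_hasDerivWithinAt₀
  refine ⟨s, hs0, fun t ht => ?_⟩
  have := (hs t (Set.Ioo_subset_Icc_self ht)).mono Set.Ioo_subset_Icc_self
  exact (this.hasFDerivWithinAt).hasMFDerivWithinAt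

/-- Discrete Grönwall inequality on a finite block. -/
theorem gronwall_block {u b c : ℕ → ℝ} {n m : ℕ} (hun : 0 ≤ u n)
    (hb : ∀ t, n ≤ t → t < m → 0 ≤ b t) (hc : ∀ t, n ≤ t → t < m → 0 ≤ c t)
    (hu : ∀ t, n ≤ t → t < m → u (t + 1) ≤ (1 + c t) * u t + b t)
    {t : ℕ} (hnt : n ≤ t) (htm : t ≤ m) :
    u t ≤ (u n + ∑ k ∈ Finset.Ico n t, b k) * Real.exp (∑ k ∈ Finset.Ico n t, c k) := by
  induction t, hnt using Nat.le_induction with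
  | base => simp
  | succ k hk ih =>
    have hkm : k < m := htm
    have ih := ih hkm.le
    rw [Finset.sum_Ico_succ_top hk, Finset.sum_Ico_succ_top hk, Real.exp_add]
    have h1 : 1 + c k ≤ Real.exp (c k) := by linarith [Real.add_one_le_exp (c k)]
    have hS : 0 ≤ ∑ k ∈ Finset.Ico n k, b k := Finset.sum_nonneg fun i hi =>
      hb i (Finset.mem_Ico.1 hi).1 ((Finset.mem_Ico.1 hi).2.trans hkm)
    have hC : 0 ≤ ∑ k ∈ Finset.Ico n k, c k := Finset.sum_nonneg fun i hi =>
      hc i (Finset.mem_Ico.1 hi).1 ((Finset.mem_Ico.1 hi).2.trans hkm)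
    have hck := hc k hk hkm
    have hbk := hb k hk hkm
    have e1 : 1 ≤ Real.exp (c k) := Real.one_le_exp hck
    have e2 : 1 ≤ Real.exp (∑ k ∈ Finset.Ico n k, c k) := Real.one_le_exp hC
    calc u (k + 1) ≤ (1 + c k) * u k + b k := hu k hk hkm
      _ ≤ Real.exp (c k) * ((u n + ∑ k ∈ Finset.Ico n k, b k)
            * Real.exp (∑ k ∈ Finset.Ico n k, c k)) + b k * 1 := by
          have : (1 + c k) * u k ≤ (1 + c k) * ((u n + ∑ k ∈ Finset.Ico n k, b k)
            * Real.exp (∑ k ∈ Finset.Ico n k, c k)) := by gcongr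
          have h2 : (1 + c k) * ((u n + ∑ k ∈ Finset.Ico n k, b k)
            * Real.exp (∑ k ∈ Finset.Ico n k, c k)) ≤ Real.exp (c k) *
            ((u n + ∑ k ∈ Finset.Ico n k, b k) * Real.exp (∑ k ∈ Finset.Ico n k, c k)) := by
            gcongr
          linarith
      _ ≤ Real.exp (c k) * ((u n + ∑ k ∈ Finset.Ico n k, b k)
            * Real.exp (∑ k ∈ Finset.Ico n k, c k)) + b k *
            (Real.exp (∑ k ∈ Finset.Ico n k, c k) * Real.exp (c k)) := by
          gcongr
          exact one_le_mul_of_one_le_of_one_le e2 e1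
      _ = _ := by ring

/-- The local error of one Euler step along an integral curve. -/
theorem euler_step_error {f : E → E} {L : ℝ≥0} (hL : LipschitzWith L f) {θs : E} (h0 : f θs = 0)
    {s : ℝ → E} (hs : ∀ t, HasDerivAt s (f (s t)) t) {B a b : ℝ} (hab : a ≤ b)
    (hB : ∀ t ∈ Set.Icc a b, ‖s t - θs‖ ≤ B) :
    ‖s b - (s a + (b - a) • f (s a))‖ ≤ (L : ℝ) ^ 2 * B * (b - a) ^ 2 := by
  have hB0 : 0 ≤ B := (norm_nonneg _).trans (hB a ⟨le_rfl, hab⟩)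
  have hf : ∀ x y, ‖f x - f y‖ ≤ L * ‖x - y‖ := fun x y => by
    simpa [dist_eq_norm] using hL.dist_le_mul x y
  have h1 : ∀ u ∈ Set.Icc a b, ‖s u - s a‖ ≤ L * B * (u - a) :=
    norm_image_sub_le_of_norm_deriv_le_segment' (fun x _ => (hs x).hasDerivWithinAt)
      (fun x hx => by
        have := hf (s x) θs
        rw [h0, sub_zero] at this
        exact this.trans (mul_le_mul_of_nonneg_left (hB x (Set.Ico_subset_Icc_self hx)) L.2))
  -- Mean value inequality for the curve minus its tangent at `a`; the derivative `f (s u) - f (s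
  -- a)` is controlled by `h1`.
  have h2 := norm_image_sub_le_of_norm_deriv_le_segment' (f := fun u => s u - (u - a) • f (s a))
    (f' := fun u => f (s u) - f (s a)) (a := a) (b := b) (C := L * (L * B * (b - a)))
    (fun x _ => by
      have := ((hasDerivAt_id x).sub_const a).smul_const (f (s a))
      rw [one_smul] at this
      exact ((hs x).sub this).hasDerivWithinAt)
    (fun x hx => (hf _ _).trans (by
      have := h1 x (Set.Ico_subset_Icc_self hx)
      have h3 : L * B * (x - a) ≤ L * B * (b - a) := by gcongr; exact hx.2.le
      gcongr
      linarith)) b ⟨hab, le_rfl⟩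
  simp only [sub_self, zero_smul, sub_zero] at h2
  calc _ = ‖s b - (b - a) • f (s a) - s a‖ := by congr 1; abel
    _ ≤ _ := h2
    _ = _ := by ring

/-- Perturbed Euler schemes for `f` with steps at most `η` halve the distance to `θs` over each block
whose total step size is in `[T, T + 1]`, up to `C` times the size of the perturbation. -/
def EulerContracts (f : E → E) (θs : E) (C T η : ℝ) : Prop :=
  ∀ (α : ℕ → ℝ) (y δ : ℕ → E) (n m : ℕ) (ε : ℝ), n ≤ m →
    0 ≤ ε → (∀ t, n ≤ t → t < m → 0 ≤ α t ∧ α t ≤ η) → ∑ t ∈ Finset.Ico n m, α t ≤ T + 1 →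
    (∀ t, n ≤ t → t < m → y (t + 1) = y t + α t • (f (y t) + δ t)) →
    (∀ t, n ≤ t → t < m → ‖δ t‖ ≤ ε) →
    (∀ t, n ≤ t → t ≤ m → ‖y t - θs‖ ≤ C * (‖y n - θs‖ + ε)) ∧
    (T ≤ ∑ t ∈ Finset.Ico n m, α t → ‖y m - θs‖ ≤ ‖y n - θs‖ / 2 + C * ε)

/-- A perturbed Euler scheme follows an exponentially stable flow over blocks of bounded length:
the distance to the equilibrium is halved over each sufficiently long block. -/
theorem exists_euler_contraction {f : E → E} {L : ℝ≥0} (hL : LipschitzWith L f) {θs : E}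
    (h0 : f θs = 0) {μ γ : ℝ} (hμ : 1 ≤ μ) (hγ : 0 < γ)
    (hflow : ∀ x, ∃ s : ℝ → E, s 0 = x ∧ (∀ t, HasDerivAt s (f (s t)) t) ∧
      ∀ t, 0 ≤ t → ‖s t - θs‖ ≤ μ * ‖x - θs‖ * Real.exp (-γ * t)) :
    ∃ C T η : ℝ, 1 ≤ C ∧ 0 < T ∧ 0 < η ∧ EulerContracts f θs C T η := by
  have hf : ∀ x y, ‖f x - f y‖ ≤ L * ‖x - y‖ := fun x y => by
    simpa [dist_eq_norm] using hL.dist_le_mul x y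
  -- The target factor 1/2 is split: 1/4 for the flow, by the choice of `T`, and 1/4 for the
  -- discretization error, by the choice of `η`. `D` is the Grönwall factor over a block.
  obtain ⟨T, hT, hTμ⟩ : ∃ T : ℝ, 0 < T ∧ ∀ t, T ≤ t → μ * Real.exp (-γ * t) ≤ 1 / 4 := by
    have : Tendsto (fun t : ℝ => μ * Real.exp (-γ * t)) atTop (𝓝 (μ * 0)) := by
      refine Tendsto.const_mul _ (Real.tendsto_exp_atBot.comp ?_)
      exact tendsto_id.const_mul_atTop_of_neg (by linarith)
    rw [mul_zero] at this
    obtain ⟨T, hT⟩ := eventually_atTop.1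
      (this.eventually (Iic_mem_nhds (by norm_num : (0 : ℝ) < 1 / 4)))
    exact ⟨max T 1, by positivity, fun t ht => hT t ((le_max_left _ _).trans ht)⟩
  set D : ℝ := (T + 1) * Real.exp (L * (T + 1)) with hD
  have hD0 : 0 ≤ D := by positivity
  set η : ℝ := 1 / (4 * (D * (L ^ 2 * μ) + 1)) with hη
  have hDL : 0 ≤ D * ((L : ℝ) ^ 2 * μ) := by positivity
  have hη0 : 0 < η := by positivity
  have hDη : D * ((L : ℝ) ^ 2 * μ * η) ≤ 1 / 4 := by
    rw [hη, mul_one_div, ← mul_div_assoc, div_le_div_iff₀ (by positivity) (by positivity)]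
    linarith
  refine ⟨μ + 1 + D, T, η, by linarith, hT, hη0, ?_⟩
  intro α y δ n m ε hnm hε hα hsum hy hδ
  obtain ⟨s, hs0, hs, hst⟩ := hflow (y n)
  set w := ‖y n - θs‖ with hw
  have hw0 : 0 ≤ w := norm_nonneg _
  let τ : ℕ → ℝ := fun t => ∑ k ∈ Finset.Ico n t, α k
  have hτ0 : ∀ t, t ≤ m → 0 ≤ τ t := fun t ht => Finset.sum_nonneg fun i hi =>
    (hα i (Finset.mem_Ico.1 hi).1 ((Finset.mem_Ico.1 hi).2.trans_le ht)).1
  have hτm : ∀ t, t ≤ m → τ t ≤ T + 1 := fun t ht => le_trans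
    (Finset.sum_le_sum_of_subset_of_nonneg (Finset.Ico_subset_Ico_right ht) fun i hi _ =>
      (hα i (Finset.mem_Ico.1 hi).1 (Finset.mem_Ico.1 hi).2).1) hsum
  have hB : ∀ t, 0 ≤ t → ‖s t - θs‖ ≤ μ * w := fun t ht => (hst t ht).trans
    (mul_le_of_le_one_right (by positivity) (Real.exp_le_one_iff.2 (by nlinarith)))
  have herr : ∀ t, n ≤ t → t ≤ m → ‖y t - s (τ t)‖ ≤ D * ((L : ℝ) ^ 2 * μ * η * w + ε) := by
    intro t hnt htm
    have hg := gronwall_block (u := fun t => ‖y t - s (τ t)‖) (c := fun t => L * α t)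
      (b := fun t => α t * ((L : ℝ) ^ 2 * μ * η * w + ε)) (n := n) (m := m) (norm_nonneg _)
      (fun k h1 h2 => mul_nonneg (hα k h1 h2).1 (by positivity))
      (fun k h1 h2 => mul_nonneg L.2 (hα k h1 h2).1) ?_ hnt htm
    · have hn : y n - s (τ n) = 0 := by simp [τ, hs0]
      simp only [hn, norm_zero, zero_add, ← Finset.sum_mul, ← Finset.mul_sum] at hg
      refine hg.trans ?_
      have h1 : Real.exp (L * τ t) ≤ Real.exp (L * (T + 1)) :=
        Real.exp_le_exp.2 (mul_le_mul_of_nonneg_left (hτm t htm) L.2)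
      calc τ t * ((L : ℝ) ^ 2 * μ * η * w + ε) * Real.exp (L * τ t)
          ≤ (T + 1) * ((L : ℝ) ^ 2 * μ * η * w + ε) * Real.exp (L * (T + 1)) := by
            gcongr
            exact hτm t htm
        _ = _ := by rw [hD]; ring
    · intro k hk hkm
      obtain ⟨ha0, haη⟩ := hα k hk hkm
      have hτs : τ (k + 1) = τ k + α k := Finset.sum_Ico_succ_top hk _
      have he := euler_step_error hL h0 hs (B := μ * w) (a := τ k) (b := τ (k + 1)) (by linarith)
        (fun u hu => hB u ((hτ0 k hkm.le).trans hu.1))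
      have hsub : τ (k + 1) - τ k = α k := by rw [hτs]; ring
      rw [hsub] at he
      -- Old error, its propagation through `f`, the perturbation, and the local Euler error.
      have heq : y (k + 1) - s (τ (k + 1)) = (y k - s (τ k)) + α k • (f (y k) - f (s (τ k)))
          + α k • δ k - (s (τ (k + 1)) - (s (τ k) + α k • f (s (τ k)))) := by
        rw [hy k hk hkm, smul_add, smul_sub]; abel
      have hn1 : ‖α k • (f (y k) - f (s (τ k)))‖ ≤ α k * (L * ‖y k - s (τ k)‖) := by
        rw [norm_smul, Real.norm_of_nonneg ha0]
        exact mul_le_mul_of_nonneg_left (hf _ _) ha0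
      have hn2 : ‖α k • δ k‖ ≤ α k * ε := by
        rw [norm_smul, Real.norm_of_nonneg ha0]
        exact mul_le_mul_of_nonneg_left (hδ k hk hkm) ha0
      -- One of the two factors `α k` is traded for `η`; the other one sums to at most `T + 1`.
      have hn3 : (L : ℝ) ^ 2 * (μ * w) * α k ^ 2 ≤ α k * ((L : ℝ) ^ 2 * μ * η * w) := by
        have : (L : ℝ) ^ 2 * (μ * w) * α k * α k ≤ (L : ℝ) ^ 2 * (μ * w) * α k * η := by gcongr
        linarith
      change ‖y (k + 1) - s (τ (k + 1))‖ ≤ (1 + L * α k) * ‖y k - s (τ k)‖ +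
        α k * ((L : ℝ) ^ 2 * μ * η * w + ε)
      rw [heq]
      have := norm_sub_le ((y k - s (τ k)) + α k • (f (y k) - f (s (τ k))) + α k • δ k)
        (s (τ (k + 1)) - (s (τ k) + α k • f (s (τ k))))
      have := norm_add₃_le (a := y k - s (τ k)) (b := α k • (f (y k) - f (s (τ k))))
        (c := α k • δ k)
      linarith
  have herr' : ∀ t, n ≤ t → t ≤ m → ‖y t - s (τ t)‖ ≤ w / 4 + D * ε := fun t h1 h2 =>
    (herr t h1 h2).trans (by nlinarith [mul_le_mul_of_nonneg_right hDη hw0])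
  have htri : ∀ t, ‖y t - θs‖ ≤ ‖y t - s (τ t)‖ + ‖s (τ t) - θs‖ := fun t =>
    norm_sub_le_norm_sub_add_norm_sub _ _ _
  refine ⟨fun t h1 h2 => ?_, fun hTs => ?_⟩
  · have := htri t
    have := herr' t h1 h2
    have := hB (τ t) (hτ0 t h2)
    nlinarith [mul_nonneg hD0 hw0]
  · have := htri m
    have := herr' m hnm le_rfl
    have h1 := hst (τ m) (hτ0 m le_rfl)
    have h2 := mul_le_mul_of_nonneg_right (hTμ (τ m) hTs) hw0
    nlinarith

/-! ### Scalar sequences along consecutive blocks -/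

/-- If the partial sums of a sequence in `(0, 1)` diverge, then they traverse any interval
`[T, T + 1]` from any starting point. -/
theorem exists_block {α : ℕ → ℝ} (hα : ∀ t, α t ∈ Set.Ioo (0 : ℝ) 1)
    (hdiv : Tendsto (fun n => ∑ t ∈ Finset.range n, α t) atTop atTop) {T : ℝ} (hT : 0 < T) (n : ℕ) :
    ∃ m, n < m ∧ T ≤ ∑ t ∈ Finset.Ico n m, α t ∧ ∑ t ∈ Finset.Ico n m, α t ≤ T + 1 := by
  have hex : ∃ m, T ≤ ∑ t ∈ Finset.Ico n m, α t := by
    obtain ⟨m, hm, hnm⟩ := ((hdiv.eventually_ge_atTop (T + ∑ t ∈ Finset.range n, α t)).and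
      (eventually_ge_atTop n)).exists
    refine ⟨m, ?_⟩
    rw [Finset.sum_Ico_eq_sub _ hnm]
    linarith
  classical
  have hm := Nat.find_spec hex
  set m := Nat.find hex with hmdef
  have hnm : n < m := by
    by_contra h
    rw [Finset.Ico_eq_empty h, Finset.sum_empty] at hm
    linarith
  refine ⟨m, hnm, hm, ?_⟩
  -- By minimality of `m` the sum without its last step is below `T`, and that step is less than 1.
  obtain ⟨k, hk⟩ : ∃ k, m = k + 1 := ⟨m - 1, by omega⟩
  have hlt := Nat.find_min hex (m := k) (by omega)
  rw [hk, Finset.sum_Ico_succ_top (by omega)]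
  linarith [(hα k).2]

/-- A sequence controlled along consecutive blocks is controlled everywhere. -/
theorem bound_of_blocks {w : ℕ → ℝ} {N : ℕ} {B C : ℝ} (hN : w N ≤ B)
    (h : ∀ n, N ≤ n → w n ≤ B → ∃ m, n < m ∧ w m ≤ B ∧ ∀ t, n ≤ t → t ≤ m → w t ≤ C)
    {t : ℕ} (ht : N ≤ t) : w t ≤ C := by
  -- The induction carries a block with `n ≤ t < m`; when `t + 1` reaches its end, the next block
  -- starts there.
  suffices hs : ∃ n m, n ≤ t ∧ t < m ∧ N ≤ m ∧ w m ≤ B ∧ ∀ s, n ≤ s → s ≤ m → w s ≤ C by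
    obtain ⟨n, m, h1, h2, -, -, h3⟩ := hs
    exact h3 t h1 h2.le
  induction t, ht using Nat.le_induction with
  | base =>
    obtain ⟨m, h1, h2, h3⟩ := h N le_rfl hN
    exact ⟨N, m, le_rfl, h1, h1.le, h2, h3⟩
  | succ k hk ih =>
    obtain ⟨n, m, h1, h2, h3, h4, h5⟩ := ih
    rcases lt_or_eq_of_le (Nat.succ_le_of_lt h2) with hlt | heq
    · exact ⟨n, m, by omega, hlt, h3, h4, h5⟩
    · obtain ⟨m', h6, h7, h8⟩ := h m h3 h4
      exact ⟨m, m', heq.ge, by omega, by omega, h7, h8⟩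

/-- A nonnegative sequence that is halved over blocks, up to arbitrarily small errors, tends to
zero. -/
theorem tendsto_zero_of_blocks {w : ℕ → ℝ} (hw : ∀ t, 0 ≤ w t) {C : ℝ} (hC : 1 ≤ C)
    (h : ∀ ε, 0 < ε → ∃ N, ∀ n, N ≤ n → ∃ m, n < m ∧ w m ≤ w n / 2 + C * ε ∧
      ∀ t, n ≤ t → t ≤ m → w t ≤ C * (w n + ε)) :
    Tendsto w atTop (𝓝 0) := by
  rw [Metric.tendsto_atTop]
  intro e he
  set ε := e / (8 * C ^ 2) with hεd
  have hε : 0 < ε := by positivity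
  obtain ⟨N, hN⟩ := h ε hε
  have hCε : 0 < C * ε := by positivity
  -- While `w n > 4 * (C * ε)`, the bound `w n / 2 + C * ε` is below `w n - C * ε`, so each block
  -- gains at least `C * ε`.
  have hreach : ∀ k : ℕ, ∀ n, N ≤ n → w n ≤ k * (C * ε) → ∃ n', N ≤ n' ∧ w n' ≤ 4 * (C * ε) := by
    intro k
    induction k with
    | zero => exact fun n hn hw' => ⟨n, hn, by push_cast at hw'; linarith⟩
    | succ k ih =>
      intro n hn hw'
      by_cases h4 : w n ≤ 4 * (C * ε)
      · exact ⟨n, hn, h4⟩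
      · obtain ⟨m, h1, h2, -⟩ := hN n hn
        refine ih m (by omega) ?_
        push_cast at hw'
        linarith
  obtain ⟨k, hk⟩ := exists_nat_ge (w N / (C * ε))
  obtain ⟨n', hn', hwn'⟩ := hreach k N le_rfl ((div_le_iff₀ hCε).1 hk)
  refine ⟨n', fun t ht => ?_⟩
  -- The level `4 * (C * ε)` is preserved, since half of it plus `C * ε` is `3 * (C * ε)`.
  have := bound_of_blocks (C := C * (4 * (C * ε) + ε)) hwn' (fun n hn hwn => by
    obtain ⟨m, h1, h2, h3⟩ := hN n (hn'.trans hn)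
    exact ⟨m, h1, by linarith, fun t h4 h5 => (h3 t h4 h5).trans (by gcongr)⟩) ht
  rw [Real.dist_eq, sub_zero, abs_of_nonneg (hw t)]
  have h5 : C * (4 * (C * ε) + ε) ≤ 5 * (C ^ 2 * ε) := by
    nlinarith [mul_le_mul_of_nonneg_left hC hCε.le]
  have h6 : C ^ 2 * ε = e / 8 := by rw [hεd]; field_simp
  linarith

/-! ### Path behaviour when the accumulated noise converges -/

/-- A stochastic approximation path whose accumulated noise converges tends to the equilibrium, if
the step sizes are not summable. -/
theorem tendsto_of_tendsto_noise {f : E → E} {L : ℝ≥0} (hL : LipschitzWith L f) {θs : E}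
    {C T η : ℝ} (hC : 1 ≤ C) (hT : 0 < T) (hη : 0 < η) (hcon : EulerContracts f θs C T η)
    {α : ℕ → ℝ} (hα : ∀ t, α t ∈ Set.Ioo (0 : ℝ) 1) (hα0 : Tendsto α atTop (𝓝 0))
    (hdiv : Tendsto (fun n => ∑ t ∈ Finset.range n, α t) atTop atTop) {x M : ℕ → E} {c : E}
    (hx : ∀ t, x (t + 1) = x t + α t • f (x t) + (M (t + 1) - M t))
    (hM : Tendsto M atTop (𝓝 c)) : Tendsto x atTop (𝓝 θs) := by
  have hr : Tendsto (fun t => c - M t) atTop (𝓝 0) := by simpa using hM.const_sub c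
  -- Adding the remaining noise `c - M t` cancels the increments of `M`; the price is the
  -- perturbation `f (x t) - f (x t + (c - M t))`, of norm at most `L * ‖c - M t‖`.
  have hy : Tendsto (fun t => ‖x t + (c - M t) - θs‖) atTop (𝓝 0) := by
    refine tendsto_zero_of_blocks (fun _ => norm_nonneg _) hC fun ε hε => ?_
    have hδ : ∀ᶠ t in atTop, (L : ℝ) * ‖c - M t‖ < ε := by
      have : Tendsto (fun t => (L : ℝ) * ‖c - M t‖) atTop (𝓝 0) := by
        simpa using hr.norm.const_mul (L : ℝ)
      exact this.eventually (gt_mem_nhds hε)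
    obtain ⟨N, hN⟩ := eventually_atTop.1 (hδ.and (hα0.eventually (gt_mem_nhds hη)))
    refine ⟨N, fun n hn => ?_⟩
    obtain ⟨m, hnm, hm1, hm2⟩ := exists_block hα hdiv hT n
    obtain ⟨h1, h2⟩ := hcon α (fun t => x t + (c - M t))
      (fun t => f (x t) - f (x t + (c - M t))) n m ε hnm.le hε.le
      (fun t h _ => ⟨(hα t).1.le, (hN t (hn.trans h)).2.le⟩) hm2
      (fun t _ _ => by
        simp only [hx t, add_sub_cancel]
        abel)
      (fun t h _ => by
        refine le_trans ?_ (hN t (hn.trans h)).1.le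
        have := hL.dist_le_mul (x t) (x t + (c - M t))
        rwa [dist_eq_norm, dist_eq_norm, sub_add_cancel_left, norm_neg] at this)
    exact ⟨m, hnm, h2 hm1, h1⟩
  have := (tendsto_zero_iff_norm_tendsto_zero.2 hy).sub hr
  rw [sub_zero] at this
  have h2 := this.add_const θs
  rw [zero_add] at h2
  exact h2.congr fun t => by abel

/-- A stochastic approximation path whose accumulated noise converges is bounded, if the step sizes
are summable. -/
theorem isBounded_of_tendsto_noise {f : E → E} {L : ℝ≥0} (hL : LipschitzWith L f) {θs : E}
    (h0 : f θs = 0) {α : ℕ → ℝ} (hα : ∀ t, 0 ≤ α t) (hsum : Summable α) {x M : ℕ → E} {c : E}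
    (hx : ∀ t, x (t + 1) = x t + α t • f (x t) + (M (t + 1) - M t))
    (hM : Tendsto M atTop (𝓝 c)) : Bornology.IsBounded (Set.range x) := by
  obtain ⟨R, hR⟩ := (Metric.isBounded_range_of_tendsto M hM).exists_norm_le
  have hR' : ∀ t, ‖M t‖ ≤ R := fun t => hR _ ⟨t, rfl⟩
  have hR0 : 0 ≤ R := (norm_nonneg _).trans (hR' 0)
  -- `x - M` moves only by `α t • f (x t)`, which grows at most linearly in its distance to `θs`.
  have hg : ∀ t, ‖x t - M t - θs‖ ≤ (‖x 0 - M 0 - θs‖ + L * R * ∑' t, α t) *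
      Real.exp (L * ∑' t, α t) := by
    intro t
    have hs := hsum.sum_le_tsum (Finset.range t) fun i _ => hα i
    refine (gronwall_block (u := fun t => ‖x t - M t - θs‖) (c := fun t => L * α t)
      (b := fun t => L * R * α t) (n := 0) (m := t) (norm_nonneg _)
      (fun k _ _ => mul_nonneg (mul_nonneg L.2 hR0) (hα k)) (fun k _ _ => mul_nonneg L.2 (hα k))
      (fun k _ _ => ?_) (Nat.zero_le t) le_rfl).trans ?_
    · have h1 : ‖f (x k)‖ ≤ L * (‖x k - M k - θs‖ + R) := by
        have h2 : ‖f (x k)‖ ≤ L * ‖x k - θs‖ := by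
          simpa [dist_eq_norm, h0] using hL.dist_le_mul (x k) θs
        refine h2.trans (mul_le_mul_of_nonneg_left ?_ L.2)
        have h3 : x k - θs = (x k - M k - θs) + M k := by abel
        rw [h3]
        exact (norm_add_le _ _).trans (by linarith [hR' k])
      have h4 : x (k + 1) - M (k + 1) - θs = (x k - M k - θs) + α k • f (x k) := by
        rw [hx k]; abel
      rw [h4]
      refine (norm_add_le _ _).trans ?_
      rw [norm_smul, Real.norm_of_nonneg (hα k)]
      nlinarith [mul_le_mul_of_nonneg_left h1 (hα k)]
    · rw [← Finset.mul_sum, ← Finset.mul_sum, ← Finset.range_eq_Ico]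
      have hL0 := L.2
      have hα' : 0 ≤ ∑' t, α t := tsum_nonneg hα
      have hLR : 0 ≤ L * R * ∑' t, α t := by positivity
      gcongr
  refine isBounded_iff_forall_norm_le.2 ⟨(‖x 0 - M 0 - θs‖ + L * R * ∑' t, α t) *
      Real.exp (L * ∑' t, α t) + R + ‖θs‖, ?_⟩
  rintro _ ⟨t, rfl⟩
  have h3 : x t = (x t - M t - θs) + M t + θs := by abel
  rw [h3]
  exact norm_add₃_le.trans (add_le_add (add_le_add (hg t) (hR' t)) le_rfl)

end Deterministic

/-! ### Mean square estimates -/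

section MeanSquare

variable {Ω : Type*} {m m0 : MeasurableSpace Ω} {P : Measure Ω} {E : Type*} [NormedAddCommGroup E]

/-- Square-integrable vectors are orthogonal to conditionally centred noise. -/
theorem integral_norm_add_smul_sq [InnerProductSpace ℝ E] [CompleteSpace E]
    [IsFiniteMeasure P] (hm : m ≤ m0) {g ξ : Ω → E} (hg : StronglyMeasurable[m] g)
    (hg2 : MemLp g 2 P) (hξ2 : MemLp ξ 2 P) (hξ : P[ξ | m] =ᵐ[P] 0) (a : ℝ) :
    ∫ ω, ‖g ω + a • ξ ω‖ ^ 2 ∂P = ∫ ω, ‖g ω‖ ^ 2 ∂P + a ^ 2 * ∫ ω, ‖ξ ω‖ ^ 2 ∂P := by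
  have ig : Integrable (fun ω => ‖g ω‖ ^ 2) P := (memLp_two_iff_integrable_sq_norm hg2.1).1 hg2
  have iξ : Integrable (fun ω => ‖ξ ω‖ ^ 2) P := (memLp_two_iff_integrable_sq_norm hξ2.1).1 hξ2
  have hint : Integrable (fun ω => innerSL ℝ (g ω) (ξ ω)) P := by
    refine (ig.add iξ).mono' (hg2.1.inner hξ2.1) (ae_of_all _ fun ω => ?_)
    simp only [innerSL_apply_apply, Pi.add_apply]
    have := norm_inner_le_norm (𝕜 := ℝ) (g ω) (ξ ω)
    nlinarith [sq_nonneg (‖g ω‖ - ‖ξ ω‖), sq_nonneg (‖g ω‖), sq_nonneg ‖ξ ω‖]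
  have horth : ∫ ω, innerSL ℝ (g ω) (ξ ω) ∂P = 0 := by
    rw [← integral_condExp hm]
    have h1 := condExp_bilin_of_stronglyMeasurable_left (innerSL ℝ) hg hint
      (hξ2.integrable one_le_two)
    rw [integral_congr_ae h1]
    have h2 : (fun ω => innerSL ℝ (g ω) (P[ξ | m] ω)) =ᵐ[P] fun _ => (0 : ℝ) := by
      filter_upwards [hξ] with ω hω
      rw [hω, Pi.zero_apply, map_zero]
    rw [integral_congr_ae h2, integral_zero]
  have hexp : ∀ ω, ‖g ω + a • ξ ω‖ ^ 2 =
      ‖g ω‖ ^ 2 + (2 * a) * innerSL ℝ (g ω) (ξ ω) + a ^ 2 * ‖ξ ω‖ ^ 2 := by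
    intro ω
    rw [norm_add_sq_real, norm_smul, mul_pow, Real.norm_eq_abs, sq_abs, inner_smul_right,
      innerSL_apply_apply]
    ring
  have i12 : Integrable (fun ω => ‖g ω‖ ^ 2 + (2 * a) * innerSL ℝ (g ω) (ξ ω)) P :=
    ig.add (hint.const_mul _)
  simp_rw [hexp]
  rw [integral_add i12 (iξ.const_mul _), integral_add ig (hint.const_mul _),
    integral_const_mul, integral_const_mul, horth]
  ring

theorem integral_norm_sq_le_of_norm_le {F : Type*} [NormedAddCommGroup F] {g : Ω → E} {h : Ω → F}
    {c : ℝ} (hh : MemLp h 2 P) (hle : ∀ ω, ‖g ω‖ ≤ c * ‖h ω‖) :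
    ∫ ω, ‖g ω‖ ^ 2 ∂P ≤ c ^ 2 * ∫ ω, ‖h ω‖ ^ 2 ∂P := by
  rw [← integral_const_mul]
  refine integral_mono_of_nonneg (ae_of_all _ fun ω => by positivity)
    (((memLp_two_iff_integrable_sq_norm hh.1).1 hh).const_mul _) (ae_of_all _ fun ω => ?_)
  simp only [← mul_pow]
  exact pow_le_pow_left₀ (norm_nonneg _) (hle ω) 2

theorem integral_norm_add_sq_le {g h : Ω → E} (hg : MemLp g 2 P) (hh : MemLp h 2 P) :
    ∫ ω, ‖g ω + h ω‖ ^ 2 ∂P ≤ 2 * ∫ ω, ‖g ω‖ ^ 2 ∂P + 2 * ∫ ω, ‖h ω‖ ^ 2 ∂P := by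
  have ig := ((memLp_two_iff_integrable_sq_norm hg.1).1 hg).const_mul 2
  have ih := ((memLp_two_iff_integrable_sq_norm hh.1).1 hh).const_mul 2
  rw [← integral_const_mul, ← integral_const_mul, ← integral_add ig ih]
  refine integral_mono_of_nonneg (ae_of_all _ fun ω => by positivity) (ig.add ih)
    (ae_of_all _ fun ω => ?_)
  have := norm_add_le (g ω) (h ω)
  simp only
  nlinarith [sq_nonneg (‖g ω‖ - ‖h ω‖), norm_nonneg (g ω + h ω)]

end MeanSquare

/-! ### Square-integrable processes -/

/-- A stochastic approximation process with square-integrable initial value, driven by martingale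
difference noise whose variance grows at most quadratically with the distance to `θs`. -/
structure IsSquareIntegrableSA {Ω : Type*} {m0 : MeasurableSpace Ω} (P : Measure Ω)
    (ℱ : Filtration ℕ m0) {d : ℕ} (f : EuclideanSpace ℝ (Fin d) → EuclideanSpace ℝ (Fin d))
    (θs : EuclideanSpace ℝ (Fin d)) (α : ℕ → ℝ) (σ : ℝ)
    (θ ξ : ℕ → Ω → EuclideanSpace ℝ (Fin d)) : Prop where
  adapted : ∀ t, StronglyMeasurable[ℱ t] (θ t)
  noise_adapted : ∀ t, StronglyMeasurable[ℱ (t + 1)] (ξ (t + 1))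
  recursion : IsSARecursion f α θ ξ
  init : MemLp (fun ω => θ 0 ω - θs) 2 P
  noise_mean : ∀ t, P[ξ (t + 1) | ℱ t] =ᵐ[P] 0
  noise_var : ∀ t, ∫⁻ ω, ‖ξ (t + 1) ω‖ₑ ^ 2 ∂P ≤
    ∫⁻ ω, ENNReal.ofReal (σ ^ 2 * (1 + ‖θ t ω - θs‖ ^ 2)) ∂P

namespace IsSquareIntegrableSA

variable {Ω : Type*} {m0 : MeasurableSpace Ω} {P : Measure Ω}
  {ℱ : Filtration ℕ m0} {d : ℕ} {f : EuclideanSpace ℝ (Fin d) → EuclideanSpace ℝ (Fin d)}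
  {θs : EuclideanSpace ℝ (Fin d)} {α : ℕ → ℝ} {σ : ℝ} {θ ξ : ℕ → Ω → EuclideanSpace ℝ (Fin d)}
  {L : ℝ≥0}

theorem stronglyMeasurable (h : IsSquareIntegrableSA P ℱ f θs α σ θ ξ) (t : ℕ) :
    StronglyMeasurable (θ t) := (h.adapted t).mono (ℱ.le t)

variable [IsProbabilityMeasure P]

/-- Conditional on square integrability at time `t`, so that it can serve in the induction proving
`memLp`. -/
theorem memLp_noise_of_memLp (h : IsSquareIntegrableSA P ℱ f θs α σ θ ξ) {t : ℕ}
    (ht : MemLp (fun ω => θ t ω - θs) 2 P) :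
    MemLp (ξ (t + 1)) 2 P ∧
      ∫ ω, ‖ξ (t + 1) ω‖ ^ 2 ∂P ≤ σ ^ 2 * (1 + ∫ ω, ‖θ t ω - θs‖ ^ 2 ∂P) := by
  have i1 : Integrable (fun ω => ‖θ t ω - θs‖ ^ 2) P :=
    (memLp_two_iff_integrable_sq_norm ht.1).1 ht
  have i2 : Integrable (fun ω => σ ^ 2 * (1 + ‖θ t ω - θs‖ ^ 2)) P :=
    ((integrable_const 1).add i1).const_mul _
  have hmeas : AEStronglyMeasurable (ξ (t + 1)) P :=
    ((h.noise_adapted t).mono (ℱ.le _)).aestronglyMeasurable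
  have heq : ∫⁻ ω, ENNReal.ofReal (σ ^ 2 * (1 + ‖θ t ω - θs‖ ^ 2)) ∂P =
      ENNReal.ofReal (σ ^ 2 * (1 + ∫ ω, ‖θ t ω - θs‖ ^ 2 ∂P)) := by
    rw [← ofReal_integral_eq_lintegral_ofReal i2 (ae_of_all _ fun ω => by positivity),
      integral_const_mul, integral_add (integrable_const 1) i1]
    simp
  have hvar := h.noise_var t
  rw [heq] at hvar
  have henorm : ∀ ω, ENNReal.ofReal (‖ξ (t + 1) ω‖ ^ 2) = ‖ξ (t + 1) ω‖ₑ ^ 2 := fun ω => by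
    rw [ENNReal.ofReal_pow (norm_nonneg _), ofReal_norm]
  constructor
  · refine (memLp_two_iff_integrable_sq_norm hmeas).2 ⟨hmeas.norm.pow 2, ?_⟩
    rw [hasFiniteIntegral_iff_ofReal (ae_of_all _ fun ω => by positivity)]
    simp_rw [henorm]
    exact hvar.trans_lt ENNReal.ofReal_lt_top
  · have hmeas2 : AEStronglyMeasurable (fun ω => ‖ξ (t + 1) ω‖ ^ 2) P := hmeas.norm.pow 2
    rw [integral_eq_lintegral_of_nonneg_ae (ae_of_all _ fun ω => by positivity) hmeas2]
    simp_rw [henorm]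
    have h0 : 0 ≤ ∫ ω, ‖θ t ω - θs‖ ^ 2 ∂P := integral_nonneg fun ω => by positivity
    exact ENNReal.toReal_le_of_le_ofReal (by positivity) hvar

theorem memLp (h : IsSquareIntegrableSA P ℱ f θs α σ θ ξ) (hL : LipschitzWith L f)
    (h0 : f θs = 0) (t : ℕ) : MemLp (fun ω => θ t ω - θs) 2 P := by
  induction t with
  | zero => exact h.init
  | succ t ih =>
    have h1 : MemLp (fun ω => f (θ t ω)) 2 P := by
      refine ih.of_le_mul (c := L)
        (hL.continuous.comp_stronglyMeasurable (h.stronglyMeasurable t)).aestronglyMeasurable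
        (ae_of_all _ fun ω => ?_)
      simpa [dist_eq_norm, h0] using hL.dist_le_mul (θ t ω) θs
    have h2 := ih.add ((h1.add (h.memLp_noise_of_memLp ih).1).const_smul (α t))
    refine h2.ae_eq (ae_of_all _ fun ω => ?_)
    simp only [Pi.add_apply, Pi.smul_apply]
    rw [h.recursion t ω]
    abel

theorem memLp_noise (h : IsSquareIntegrableSA P ℱ f θs α σ θ ξ) (hL : LipschitzWith L f)
    (h0 : f θs = 0) (t : ℕ) : MemLp (ξ (t + 1)) 2 P :=
  (h.memLp_noise_of_memLp (h.memLp hL h0 t)).1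

theorem noise_sq_le (h : IsSquareIntegrableSA P ℱ f θs α σ θ ξ) (hL : LipschitzWith L f)
    (h0 : f θs = 0) (t : ℕ) :
    ∫ ω, ‖ξ (t + 1) ω‖ ^ 2 ∂P ≤ σ ^ 2 * (1 + ∫ ω, ‖θ t ω - θs‖ ^ 2 ∂P) :=
  (h.memLp_noise_of_memLp (h.memLp hL h0 t)).2

/-- One step of the mean square distance between the process and a noiseless Euler scheme. -/
theorem sq_dist_succ_le (h : IsSquareIntegrableSA P ℱ f θs α σ θ ξ) (hL : LipschitzWith L f)
    (h0 : f θs = 0) {t : ℕ} (hα : α t ∈ Set.Ioo (0 : ℝ) 1)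
    {z z' : Ω → EuclideanSpace ℝ (Fin d)} (hz : StronglyMeasurable[ℱ t] z)
    (hz2 : MemLp (fun ω => z ω - θs) 2 P) (hz' : ∀ ω, z' ω = z ω + α t • f (z ω)) :
    ∫ ω, ‖θ (t + 1) ω - z' ω‖ ^ 2 ∂P ≤ (1 + (2 * L + L ^ 2) * α t) * ∫ ω, ‖θ t ω - z ω‖ ^ 2 ∂P +
      α t ^ 2 * (σ ^ 2 * (1 + ∫ ω, ‖θ t ω - θs‖ ^ 2 ∂P)) := by
  set e : Ω → EuclideanSpace ℝ (Fin d) := fun ω => θ t ω - z ω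
  set g : Ω → EuclideanSpace ℝ (Fin d) := fun ω => e ω + α t • (f (θ t ω) - f (z ω))
  have he : MemLp e 2 P := ((h.memLp hL h0 t).sub hz2).ae_eq (ae_of_all _ fun ω => by
    simp [e])
  have hgm : StronglyMeasurable[ℱ t] g :=
    ((h.adapted t).sub hz).add (((hL.continuous.comp_stronglyMeasurable (h.adapted t)).sub
      (hL.continuous.comp_stronglyMeasurable hz)).const_smul (α t))
  have hge : ∀ ω, ‖g ω‖ ≤ (1 + α t * L) * ‖e ω‖ := fun ω => by
    refine (norm_add_le _ _).trans ?_
    rw [norm_smul, Real.norm_of_nonneg hα.1.le]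
    have h1 : ‖f (θ t ω) - f (z ω)‖ ≤ L * ‖e ω‖ := by
      simpa [dist_eq_norm] using hL.dist_le_mul (θ t ω) (z ω)
    nlinarith [mul_le_mul_of_nonneg_left h1 hα.1.le]
  have hg2 : MemLp g 2 P :=
    he.of_le_mul (hgm.mono (ℱ.le t)).aestronglyMeasurable (ae_of_all _ hge)
  have heq : ∀ ω, θ (t + 1) ω - z' ω = g ω + α t • ξ (t + 1) ω := fun ω => by
    simp only [g, e]
    rw [h.recursion t ω, hz' ω, smul_add, smul_sub]
    abel
  simp_rw [heq]
  rw [integral_norm_add_smul_sq (ℱ.le t) hgm hg2 (h.memLp_noise hL h0 t) (h.noise_mean t)]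
  have hI : 0 ≤ ∫ ω, ‖e ω‖ ^ 2 ∂P := integral_nonneg fun ω => by positivity
  have hsq : (1 + α t * L) ^ 2 ≤ 1 + (2 * L + (L : ℝ) ^ 2) * α t := by
    have := mul_nonneg (mul_nonneg hα.1.le (sub_nonneg.2 hα.2.le)) (sq_nonneg (L : ℝ))
    nlinarith
  refine add_le_add ((integral_norm_sq_le_of_norm_le he hge).trans ?_) ?_
  · exact mul_le_mul_of_nonneg_right hsq hI
  · exact mul_le_mul_of_nonneg_left (h.noise_sq_le hL h0 t) (sq_nonneg _)

/-- The mean square distance to the equilibrium is bounded if the step sizes are summable. -/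
theorem exists_sq_le_of_summable (h : IsSquareIntegrableSA P ℱ f θs α σ θ ξ)
    (hL : LipschitzWith L f) (h0 : f θs = 0) (hα : ∀ t, α t ∈ Set.Ioo (0 : ℝ) 1)
    (hs1 : Summable α) : ∃ R, ∀ t, ∫ ω, ‖θ t ω - θs‖ ^ 2 ∂P ≤ R := by
  set u : ℕ → ℝ := fun t => ∫ ω, ‖θ t ω - θs‖ ^ 2 ∂P with hu
  have hu0 : ∀ t, 0 ≤ u t := fun t => integral_nonneg fun ω => by positivity
  set c : ℝ := 2 * L + L ^ 2 + σ ^ 2 with hc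
  have hc0 : 0 ≤ c := by positivity
  have hαn : ∀ t, 0 ≤ α t := fun t => (hα t).1.le
  have hαt : 0 ≤ ∑' t, α t := tsum_nonneg hαn
  refine ⟨(u 0 + σ ^ 2 * ∑' t, α t) * Real.exp (c * ∑' t, α t), fun t => ?_⟩
  have hst := hs1.sum_le_tsum (Finset.range t) fun i _ => hαn i
  refine (gronwall_block (u := u) (c := fun t => c * α t) (b := fun t => σ ^ 2 * α t) (n := 0)
    (m := t) (hu0 0) (fun k _ _ => mul_nonneg (sq_nonneg _) (hαn k))
    (fun k _ _ => mul_nonneg hc0 (hαn k)) (fun k _ _ => ?_) (Nat.zero_le t) le_rfl).trans ?_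
  -- The comparison scheme is the one resting at `θs`.
  · have := h.sq_dist_succ_le hL h0 (hα k) (z := fun _ => θs) (z' := fun _ => θs)
      stronglyMeasurable_const (by simp) (by simp [h0])
    refine this.trans ?_
    -- Since `α k < 1`, the quadratic noise term fits into the linear Grönwall coefficient; this is
    -- the `σ ^ 2` in `c`.
    have h1 : α k ^ 2 ≤ α k := by nlinarith [(hα k).1, (hα k).2]
    have h2 : 0 ≤ σ ^ 2 * (1 + u k) := mul_nonneg (sq_nonneg _) (by linarith [hu0 k])
    have h3 := mul_le_mul_of_nonneg_right h1 h2
    change (1 + (2 * L + L ^ 2) * α k) * u k + α k ^ 2 * (σ ^ 2 * (1 + u k)) ≤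
      (1 + c * α k) * u k + σ ^ 2 * α k
    rw [hc]
    linarith
  · rw [← Finset.mul_sum, ← Finset.mul_sum, ← Finset.range_eq_Ico]
    have := hu0 0
    gcongr

end IsSquareIntegrableSA

/-- The noiseless Euler scheme that stays at `x` up to time `n`. -/
def eulerFrom {E : Type*} [AddCommGroup E] [Module ℝ E] (f : E → E) (α : ℕ → ℝ) (n : ℕ) (x : E) :
    ℕ → E
  | 0 => x
  | t + 1 => if t < n then x else eulerFrom f α n x t + α t • f (eulerFrom f α n x t)

theorem eulerFrom_of_le {E : Type*} [AddCommGroup E] [Module ℝ E] (f : E → E) (α : ℕ → ℝ) {n t : ℕ}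
    (x : E) (h : t ≤ n) : eulerFrom f α n x t = x := by
  cases t with
  | zero => rfl
  | succ t => rw [eulerFrom, if_pos (by omega)]

theorem eulerFrom_succ {E : Type*} [AddCommGroup E] [Module ℝ E] (f : E → E) (α : ℕ → ℝ) {n t : ℕ}
    (x : E) (h : n ≤ t) : eulerFrom f α n x (t + 1) =
      eulerFrom f α n x t + α t • f (eulerFrom f α n x t) := by
  rw [eulerFrom, if_neg (by omega)]

/-- Makes the scheme started from the random point `θ n` measurable at time `n`. -/
theorem continuous_eulerFrom {E : Type*} [NormedAddCommGroup E] [NormedSpace ℝ E] {f : E → E}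
    (hf : Continuous f) (α : ℕ → ℝ) (n t : ℕ) : Continuous fun x => eulerFrom f α n x t := by
  induction t with
  | zero => exact continuous_id
  | succ t ih =>
    by_cases h : t < n
    · simp only [eulerFrom, if_pos h]
      exact continuous_id
    · simp only [eulerFrom, if_neg h]
      exact ih.add ((hf.comp ih).const_smul _)

/-! ### Mean square contraction and convergence of the noise -/

namespace IsSquareIntegrableSA

variable {Ω : Type*} {m0 : MeasurableSpace Ω} {P : Measure Ω} [IsProbabilityMeasure P]
  {ℱ : Filtration ℕ m0} {d : ℕ} {f : EuclideanSpace ℝ (Fin d) → EuclideanSpace ℝ (Fin d)}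
  {θs : EuclideanSpace ℝ (Fin d)} {α : ℕ → ℝ} {σ : ℝ} {θ ξ : ℕ → Ω → EuclideanSpace ℝ (Fin d)}
  {L : ℝ≥0}

/-- Mean square contraction over blocks. -/
theorem exists_block_sq_le (h : IsSquareIntegrableSA P ℱ f θs α σ θ ξ)
    (hL : LipschitzWith L f) (h0 : f θs = 0) (hα : ∀ t, α t ∈ Set.Ioo (0 : ℝ) 1) {C T η : ℝ}
    (hC : 1 ≤ C) (hcon : EulerContracts f θs C T η) :
    ∃ K, 0 ≤ K ∧ ∀ n m, n ≤ m → (∀ t, n ≤ t → α t ≤ η) → ∑ t ∈ Finset.Ico n m, α t ≤ T + 1 →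
      (∀ t, n ≤ t → t ≤ m → ∫ ω, ‖θ t ω - θs‖ ^ 2 ∂P ≤
        K * (∑ k ∈ Finset.Ico n m, α k ^ 2) * (1 + ∫ ω, ‖θ n ω - θs‖ ^ 2 ∂P) +
          2 * C ^ 2 * ∫ ω, ‖θ n ω - θs‖ ^ 2 ∂P) ∧
      (T ≤ ∑ t ∈ Finset.Ico n m, α t → ∫ ω, ‖θ m ω - θs‖ ^ 2 ∂P ≤
        K * (∑ k ∈ Finset.Ico n m, α k ^ 2) * (1 + ∫ ω, ‖θ n ω - θs‖ ^ 2 ∂P) +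
          (∫ ω, ‖θ n ω - θs‖ ^ 2 ∂P) / 2) := by
  set c : ℝ := 2 * L + L ^ 2 + 2 * σ ^ 2 with hc
  have hc0 : 0 ≤ c := by positivity
  refine ⟨2 * (σ ^ 2 * (2 * C ^ 2) * Real.exp (c * (T + 1))), by positivity, ?_⟩
  intro n m hnm hη hsum
  set u : ℕ → ℝ := fun t => ∫ ω, ‖θ t ω - θs‖ ^ 2 ∂P with hu
  have hu0 : ∀ t, 0 ≤ u t := fun t => integral_nonneg fun ω => by positivity
  let z : ℕ → Ω → EuclideanSpace ℝ (Fin d) := fun t ω => eulerFrom f α n (θ n ω) t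
  let v : ℕ → ℝ := fun t => ∫ ω, ‖θ t ω - z t ω‖ ^ 2 ∂P
  have hzn : ∀ ω, z n ω = θ n ω := fun ω => eulerFrom_of_le f α _ le_rfl
  -- Pathwise contraction with zero perturbation.
  have hzt : ∀ ω, (∀ t, n ≤ t → t ≤ m → ‖z t ω - θs‖ ≤ C * ‖θ n ω - θs‖) ∧
      (T ≤ ∑ t ∈ Finset.Ico n m, α t → ‖z m ω - θs‖ ≤ 1 / 2 * ‖θ n ω - θs‖) := fun ω => by
    obtain ⟨h1, h2⟩ := hcon α (fun t => z t ω) (fun _ => 0) n m 0 hnm le_rfl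
      (fun t h1 h2 => ⟨(hα t).1.le, hη t h1⟩) hsum
      (fun t h1 _ => by rw [add_zero]; exact eulerFrom_succ f α _ h1) (by simp)
    simp only [hzn, add_zero, mul_zero] at h1 h2
    exact ⟨h1, fun h3 => (h2 h3).trans_eq (by ring)⟩
  have hzm : ∀ t, n ≤ t → StronglyMeasurable[ℱ t] (z t) := fun t hnt =>
    (continuous_eulerFrom hL.continuous α n t).comp_stronglyMeasurable
      ((h.adapted n).mono (ℱ.mono hnt))
  have hθ2 := h.memLp hL h0
  have hz2 : ∀ t, n ≤ t → t ≤ m → MemLp (fun ω => z t ω - θs) 2 P := fun t h1 h2 =>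
    (hθ2 n).of_le_mul (((hzm t h1).mono (ℱ.le t)).sub
      stronglyMeasurable_const).aestronglyMeasurable (ae_of_all _ fun ω => (hzt ω).1 t h1 h2)
  have he2 : ∀ t, n ≤ t → t ≤ m → MemLp (fun ω => θ t ω - z t ω) 2 P := fun t h1 h2 =>
    ((hθ2 t).sub (hz2 t h1 h2)).ae_eq (ae_of_all _ fun ω => by simp)
  have huv : ∀ t, n ≤ t → t ≤ m → u t ≤ 2 * v t + 2 * ∫ ω, ‖z t ω - θs‖ ^ 2 ∂P := by
    intro t h1 h2
    have := integral_norm_add_sq_le (he2 t h1 h2) (hz2 t h1 h2)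
    simpa only [sub_add_sub_cancel] using this
  have huv' : ∀ t, n ≤ t → t ≤ m → u t ≤ 2 * v t + 2 * C ^ 2 * u n := fun t h1 h2 => by
    have := integral_norm_sq_le_of_norm_le (hθ2 n) fun ω => (hzt ω).1 t h1 h2
    linarith [huv t h1 h2]
  set a : ℝ := ∑ k ∈ Finset.Ico n m, α k ^ 2 with ha
  have ha0 : 0 ≤ a := Finset.sum_nonneg fun _ _ => sq_nonneg _
  have hC2 : 1 ≤ C ^ 2 := one_le_pow₀ hC
  set A : ℝ := σ ^ 2 * (2 * C ^ 2) * (1 + u n) with hA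
  have hA0 : 0 ≤ A := mul_nonneg (by positivity) (by linarith [hu0 n])
  have hv : ∀ t, n ≤ t → t ≤ m → v t ≤ a * A * Real.exp (c * (T + 1)) := by
    intro t h1 h2
    refine (gronwall_block (u := v) (c := fun t => c * α t) (b := fun t => α t ^ 2 * A) (n := n)
      (m := m) (integral_nonneg fun ω => by positivity)
      (fun k _ _ => mul_nonneg (sq_nonneg _) hA0)
      (fun k _ _ => mul_nonneg hc0 (hα k).1.le) (fun k hk hkm => ?_) h1 h2).trans ?_
    · have hstep := h.sq_dist_succ_le hL h0 (hα k) (hzm k hk) (hz2 k hk hkm.le)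
        (z' := z (k + 1)) (fun ω => eulerFrom_succ f α _ hk)
      change v (k + 1) ≤ (1 + (2 * L + L ^ 2) * α k) * v k + α k ^ 2 * (σ ^ 2 * (1 + u k)) at hstep
      refine hstep.trans ?_
      have hvk : 0 ≤ v k := integral_nonneg fun ω => by positivity
      have hk1 : α k ^ 2 ≤ α k := by nlinarith [(hα k).1, (hα k).2]
      -- The noise variance is expressed through `v k` and the start of the block, which closes the
      -- recursion for `v`; `1 ≤ C ^ 2` absorbs the constant 1.
      have e1 : 1 + u k ≤ 2 * v k + 2 * C ^ 2 * (1 + u n) := by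
        linarith [huv' k hk hkm.le]
      have e2 : α k ^ 2 * (σ ^ 2 * (1 + u k)) ≤
          α k ^ 2 * (σ ^ 2 * (2 * v k + 2 * C ^ 2 * (1 + u n))) := by gcongr
      have e3 : α k ^ 2 * (σ ^ 2 * (2 * v k)) ≤ α k * (σ ^ 2 * (2 * v k)) := by gcongr
      rw [hc, hA]
      linarith
    · have hvn : v n = 0 := by simp [v, hzn]
      rw [hvn, zero_add, ← Finset.sum_mul, ← Finset.mul_sum]
      have e1 : ∑ k ∈ Finset.Ico n t, α k ^ 2 ≤ a :=
        Finset.sum_le_sum_of_subset_of_nonneg (Finset.Ico_subset_Ico_right h2)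
          fun _ _ _ => sq_nonneg _
      have e2 : ∑ k ∈ Finset.Ico n t, α k ≤ T + 1 := le_trans
        (Finset.sum_le_sum_of_subset_of_nonneg (Finset.Ico_subset_Ico_right h2)
          fun k _ _ => (hα k).1.le) hsum
      gcongr
  have hK : ∀ t, n ≤ t → t ≤ m →
      2 * v t ≤ 2 * (σ ^ 2 * (2 * C ^ 2) * Real.exp (c * (T + 1))) * a * (1 + u n) := fun t h1 h2 =>
    (mul_le_mul_of_nonneg_left (hv t h1 h2) zero_le_two).trans_eq (by rw [hA]; ring)
  refine ⟨fun t h1 h2 => (huv' t h1 h2).trans (by linarith [hK t h1 h2]), fun h3 => ?_⟩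
  -- Squaring the factor 1/2 gives 1/4, so the factor 2 lost in `huv` still leaves 1/2.
  have := integral_norm_sq_le_of_norm_le (hθ2 n) fun ω => (hzt ω).2 h3
  change _ ≤ _ * u n at this
  linarith [huv m hnm le_rfl, hK m hnm le_rfl]

/-- The mean square distance to the equilibrium is bounded if the step sizes are square summable
but not summable. -/
theorem exists_sq_le_of_not_summable (h : IsSquareIntegrableSA P ℱ f θs α σ θ ξ)
    (hL : LipschitzWith L f) (h0 : f θs = 0) (hα : ∀ t, α t ∈ Set.Ioo (0 : ℝ) 1) {C T η : ℝ}
    (hC : 1 ≤ C) (hT : 0 < T) (hη : 0 < η) (hcon : EulerContracts f θs C T η)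
    (hs2 : Summable fun t => α t ^ 2)
    (hdiv : Tendsto (fun n => ∑ t ∈ Finset.range n, α t) atTop atTop)
    (hα0 : Tendsto α atTop (𝓝 0)) : ∃ R, ∀ t, ∫ ω, ‖θ t ω - θs‖ ^ 2 ∂P ≤ R := by
  obtain ⟨K, hK, hblock⟩ := h.exists_block_sq_le hL h0 hα hC hcon
  set u : ℕ → ℝ := fun t => ∫ ω, ‖θ t ω - θs‖ ^ 2 ∂P with hu
  have hu0 : ∀ t, 0 ≤ u t := fun t => integral_nonneg fun ω => by positivity
  obtain ⟨N₁, hN₁⟩ := eventually_atTop.1 (hα0.eventually (gt_mem_nhds hη))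
  obtain ⟨N₂, hN₂⟩ : ∃ N₂, ∀ n, N₂ ≤ n → ∀ m, n ≤ m →
      K * ∑ k ∈ Finset.Ico n m, α k ^ 2 ≤ 1 / 4 := by
    have hδ : (0 : ℝ) < 1 / (4 * (K + 1)) := by positivity
    obtain ⟨N, hN⟩ := Metric.cauchySeq_iff.1 hs2.hasSum.tendsto_sum_nat.cauchySeq _ hδ
    refine ⟨N, fun n hn m hnm => ?_⟩
    have h1 := hN m (hn.trans hnm) n hn
    rw [Real.dist_eq, ← Finset.sum_Ico_eq_sub _ hnm] at h1
    have h2 := (le_abs_self _).trans h1.le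
    calc K * ∑ k ∈ Finset.Ico n m, α k ^ 2 ≤ (K + 1) * (1 / (4 * (K + 1))) := by
          gcongr
          linarith
      _ = 1 / 4 := by field_simp
  set N := max N₁ N₂ with hN
  -- The level `B` survives a block because `(1 + B) / 4 + B / 2 ≤ B` for `B ≥ 1`.
  set B := max (u N) 1 with hB
  have hB1 : 1 ≤ B := le_max_right _ _
  have hbd : ∀ t, N ≤ t → u t ≤ 1 / 4 * (1 + B) + 2 * C ^ 2 * B := fun t ht => by
    refine bound_of_blocks (w := u) (B := B) (le_max_left _ _) (fun n hn hun => ?_) ht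
    obtain ⟨m, hnm, hm1, hm2⟩ := exists_block hα hdiv hT n
    obtain ⟨b1, b2⟩ := hblock n m hnm.le
      (fun t ht => (hN₁ t (((le_max_left _ _).trans hn).trans ht)).le) hm2
    have hsm := hN₂ n ((le_max_right _ _).trans hn) m hnm.le
    have hsm' := mul_le_mul_of_nonneg_right hsm (show 0 ≤ 1 + u n by linarith [hu0 n])
    refine ⟨m, hnm, ?_, fun t h1 h2 => ?_⟩
    · linarith [b2 hm1]
    · have := mul_le_mul_of_nonneg_left hun (show 0 ≤ 2 * C ^ 2 by positivity)
      linarith [b1 t h1 h2]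
  refine ⟨1 / 4 * (1 + B) + 2 * C ^ 2 * B + ∑ t ∈ Finset.range N, u t, fun t => ?_⟩
  have hS : 0 ≤ ∑ t ∈ Finset.range N, u t := Finset.sum_nonneg fun i _ => hu0 i
  rcases le_or_gt N t with ht | ht
  · linarith [hbd t ht]
  · have := Finset.single_le_sum (f := u) (fun i _ => hu0 i) (Finset.mem_range.2 ht)
    have : 0 ≤ 1 / 4 * (1 + B) + 2 * C ^ 2 * B := by positivity
    linarith

/-- The accumulated noise converges almost surely. -/
theorem ae_tendsto_noise (h : IsSquareIntegrableSA P ℱ f θs α σ θ ξ) (hL : LipschitzWith L f)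
    (h0 : f θs = 0) (hs2 : Summable fun t => α t ^ 2) {R : ℝ}
    (hR : ∀ t, ∫ ω, ‖θ t ω - θs‖ ^ 2 ∂P ≤ R) :
    ∀ᵐ ω ∂P, ∃ c, Tendsto (fun t => ∑ k ∈ Finset.range t, α k • ξ (k + 1) ω) atTop (𝓝 c) := by
  set M : ℕ → Ω → EuclideanSpace ℝ (Fin d) :=
    fun t ω => ∑ k ∈ Finset.range t, α k • ξ (k + 1) ω with hM
  have hMs : ∀ t, M (t + 1) = fun ω => M t ω + α t • ξ (t + 1) ω := fun t => by
    funext ω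
    exact Finset.sum_range_succ _ _
  have hMm : ∀ t, StronglyMeasurable[ℱ t] (M t) := fun t => by
    induction t with
    | zero => simpa [hM] using stronglyMeasurable_const
    | succ t ih =>
      rw [hMs]
      exact (ih.mono (ℱ.mono t.le_succ)).add ((h.noise_adapted t).const_smul (α t))
  have hM2 : ∀ t, MemLp (M t) 2 P := fun t => by
    induction t with
    | zero => simp [hM]
    | succ t ih =>
      rw [hMs]
      exact ih.add ((h.memLp_noise hL h0 t).const_smul (α t))
  have hR0 : 0 ≤ R := (integral_nonneg fun ω => by positivity).trans (hR 0)
  -- Orthogonality of the increments makes the second moments add up.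
  have hMb : ∀ t, ∫ ω, ‖M t ω‖ ^ 2 ∂P ≤ ∑' k, α k ^ 2 * (σ ^ 2 * (1 + R)) := fun t => by
    refine le_trans ?_ ((hs2.mul_right _).sum_le_tsum (Finset.range t)
      fun i _ => by positivity)
    induction t with
    | zero => simp [hM]
    | succ t ih =>
      rw [hMs, Finset.sum_range_succ, integral_norm_add_smul_sq (ℱ.le t) (hMm t) (hM2 t)
        (h.memLp_noise hL h0 t) (h.noise_mean t)]
      have h1 := (h.noise_sq_le hL h0 t).trans
        (mul_le_mul_of_nonneg_left (add_le_add_right (hR t) 1) (sq_nonneg σ))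
      exact add_le_add ih (mul_le_mul_of_nonneg_left h1 (sq_nonneg _))
  set Q : ℝ := ∑' k, α k ^ 2 * (σ ^ 2 * (1 + R))
  -- Each coordinate is a real martingale, bounded in `L¹` because `|x| ≤ 1 + x ^ 2`.
  have hcoord : ∀ i : Fin d, ∀ᵐ ω ∂P, ∃ c, Tendsto (fun t => M t ω i) atTop (𝓝 c) := by
    intro i
    have hle : ∀ x : EuclideanSpace ℝ (Fin d), ‖x i‖ ≤ ‖x‖ := fun x => PiLp.norm_apply_le x i
    have hint : ∀ t, Integrable (fun ω => M t ω i) P := fun t =>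
      (EuclideanSpace.proj (𝕜 := ℝ) i).integrable_comp ((hM2 t).integrable one_le_two)
    have hmart : Martingale (fun t ω => M t ω i) ℱ P := by
      refine martingale_of_condExp_sub_eq_zero_nat
        (fun t => (EuclideanSpace.proj (𝕜 := ℝ) i).continuous.comp_stronglyMeasurable (hMm t))
        hint fun t => ?_
      have h1 := ContinuousLinearMap.comp_condExp_comm (m := ℱ t)
        ((h.memLp_noise hL h0 t).integrable one_le_two) (α t • EuclideanSpace.proj (𝕜 := ℝ) i)
      have h2 : (fun ω => M (t + 1) ω i) - (fun ω => M t ω i) =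
          (α t • EuclideanSpace.proj (𝕜 := ℝ) i : EuclideanSpace ℝ (Fin d) →L[ℝ] ℝ) ∘
            ξ (t + 1) := by
        funext ω
        simp [hMs]
      rw [h2]
      refine h1.symm.trans ?_
      filter_upwards [h.noise_mean t] with ω hω
      rw [Function.comp_apply, hω, Pi.zero_apply, map_zero, Pi.zero_apply]
    refine hmart.submartingale.exists_ae_tendsto_of_bdd (R := (1 + Q).toNNReal) fun t => ?_
    have hsq : Integrable (fun ω => ‖M t ω‖ ^ 2) P :=
      (memLp_two_iff_integrable_sq_norm (hM2 t).1).1 (hM2 t)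
    have h1 : ∫ ω, ‖M t ω i‖ ∂P ≤ 1 + Q := by
      have : ∫ ω, ‖M t ω i‖ ∂P ≤ ∫ ω, (1 + ‖M t ω‖ ^ 2) ∂P := by
        refine integral_mono (hint t).norm ((integrable_const 1).add hsq) fun ω => ?_
        have := hle (M t ω)
        simp only
        nlinarith [sq_nonneg (‖M t ω‖ - 1), norm_nonneg (M t ω)]
      rw [integral_add (integrable_const 1) hsq] at this
      simp only [integral_const, probReal_univ, smul_eq_mul, mul_one] at this
      linarith [hMb t]
    rw [eLpNorm_one_eq_lintegral_enorm]
    change _ ≤ ENNReal.ofReal (1 + Q)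
    rw [← ofReal_integral_norm_eq_lintegral_enorm (hint t)]
    exact ENNReal.ofReal_le_ofReal h1
  filter_upwards [ae_all_iff.2 hcoord] with ω hω
  choose c hc using hω
  refine ⟨WithLp.toLp 2 c, ?_⟩
  have h1 : Tendsto (fun t => WithLp.ofLp (M t ω)) atTop (𝓝 c) := tendsto_pi_nhds.2 hc
  exact ((PiLp.continuous_toLp 2 _).tendsto c).comp h1

end IsSquareIntegrableSA

/-! ### The filtration of the history -/

section History

variable {Ω : Type*} {d : ℕ} {θ ξ : ℕ → Ω → EuclideanSpace ℝ (Fin d)}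

theorem measurable_history_state {s t : ℕ} (hst : s ≤ t) : Measurable[history θ ξ t] (θ s) :=
  measurable_iff_comap_le.2 (le_sup_of_le_left
    (le_iSup₂_of_le (f := fun i (_ : i ∈ Set.Icc 0 t) => MeasurableSpace.comap (θ i) inferInstance)
      s ⟨Nat.zero_le s, hst⟩ le_rfl))

theorem measurable_history_noise (t : ℕ) : Measurable[history θ ξ (t + 1)] (ξ (t + 1)) :=
  measurable_iff_comap_le.2 (le_sup_of_le_right
    (le_iSup₂_of_le
      (f := fun i (_ : i ∈ Set.Icc 1 (t + 1)) => MeasurableSpace.comap (ξ i) inferInstance)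
      (t + 1) ⟨Nat.le_add_left 1 t, le_rfl⟩ le_rfl))

variable [m0 : MeasurableSpace Ω]

theorem IsSARecursion.measurable {f : EuclideanSpace ℝ (Fin d) → EuclideanSpace ℝ (Fin d)}
    {α : ℕ → ℝ} (hrec : IsSARecursion f α θ ξ) (hf : Continuous f) (hθ0 : Measurable (θ 0))
    (hξ : ∀ t, Measurable (ξ (t + 1))) (t : ℕ) : Measurable (θ t) := by
  induction t with
  | zero => exact hθ0
  | succ t ih =>
    rw [funext (hrec t)]
    exact ih.add (((hf.measurable.comp ih).add (hξ t)).const_smul (α t))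

/-- The σ-algebras `history θ ξ t` as a filtration. -/
def historyFiltration (hθ : ∀ t, Measurable (θ t)) (hξ : ∀ t, Measurable (ξ (t + 1))) :
    Filtration ℕ m0 where
  seq := history θ ξ
  mono' := fun s t hst => sup_le_sup
    (biSup_mono fun i hi => ⟨hi.1, hi.2.trans hst⟩)
    (biSup_mono fun i hi => ⟨hi.1, hi.2.trans hst⟩)
  le' := fun t => sup_le (iSup₂_le fun i _ => (hθ i).comap_le) (iSup₂_le fun i hi => by
    -- The noise index starts at 1, so `ξ 0` does not enter.
    obtain ⟨j, rfl⟩ : ∃ j, i = j + 1 := ⟨i - 1, (Nat.sub_add_cancel hi.1).symm⟩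
    exact (hξ j).comap_le)

end History

/-! ### Localization on the initial value -/

variable {Ω : Type*} [MeasurableSpace Ω] {P : Measure Ω} [IsProbabilityMeasure P] {d : ℕ}
  {f : EuclideanSpace ℝ (Fin d) → EuclideanSpace ℝ (Fin d)} {θs : EuclideanSpace ℝ (Fin d)}
  {α : ℕ → ℝ} {θ ξ : ℕ → Ω → EuclideanSpace ℝ (Fin d)}

open Classical in
/-- Freezing a stochastic approximation process at the equilibrium outside of an event on which its
initial value is bounded makes it square integrable. -/
theorem isSquareIntegrableSA_localized {A : Set Ω} (hAm : MeasurableSet[history θ ξ 0] A) {k : ℝ}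
    (hAk : ∀ ω ∈ A, ‖θ 0 ω - θs‖ ≤ k) (hf : Continuous f) (h0 : f θs = 0)
    (hθ0 : Measurable (θ 0)) (hξ : ∀ t, Measurable (ξ (t + 1))) (hrec : IsSARecursion f α θ ξ)
    (hN1 : NoiseMeanZero P θ ξ) {σ : ℝ}
    (hσ : ∀ t : ℕ, P⁻[fun ω => ‖ξ (t + 1) ω‖ₑ ^ 2 | history θ ξ t] ≤ᵐ[P]
      fun ω => ENNReal.ofReal (σ ^ 2 * (1 + ‖θ t ω - θs‖ ^ 2))) :
    IsSquareIntegrableSA P (historyFiltration (hrec.measurable hf hθ0 hξ) hξ) f θs α σ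
      (fun t => A.piecewise (θ t) (fun _ => θs)) (fun t => A.indicator (ξ t)) := by
  set ℱ := historyFiltration (hrec.measurable hf hθ0 hξ) hξ
  have hA : ∀ t, MeasurableSet[ℱ t] A := fun t => ℱ.mono (Nat.zero_le t) _ hAm
  have hadapt : ∀ t, StronglyMeasurable[ℱ t] (A.piecewise (θ t) (fun _ => θs)) := fun t =>
    StronglyMeasurable.piecewise (hA t)
      (Measurable.stronglyMeasurable (measurable_history_state le_rfl)) stronglyMeasurable_const
  refine ⟨hadapt, fun t => ?_, fun t ω => ?_, ?_, fun t => ?_, fun t => ?_⟩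
  · exact (Measurable.stronglyMeasurable (measurable_history_noise t)).indicator (hA (t + 1))
  · by_cases hω : ω ∈ A
    · simp [hω, hrec t ω]
    · simp [hω, h0]
  -- `|k|` instead of `k`: off `A` the bound must be nonnegative, and `k` may be negative.
  · refine MemLp.of_bound
      (((hadapt 0).mono (ℱ.le 0)).sub stronglyMeasurable_const).aestronglyMeasurable |k|
      (ae_of_all _ fun ω => ?_)
    by_cases hω : ω ∈ A
    · simpa [hω] using (hAk ω hω).trans (le_abs_self k)
    · simp [hω]
  · refine (condExp_indicator (hN1 t).1 (hA t)).trans ?_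
    filter_upwards [(hN1 t).2] with ω hω
    by_cases hA' : ω ∈ A
    · rw [Set.indicator_of_mem hA']
      exact hω
    · simp [hA']
  · have hA0 : MeasurableSet A := ℱ.le t _ (hA t)
    have h1 : ∀ ω, ‖A.indicator (ξ (t + 1)) ω‖ₑ ^ 2 =
        A.indicator (fun ω => ‖ξ (t + 1) ω‖ₑ ^ 2) ω := fun ω => by
      by_cases hω : ω ∈ A <;> simp [hω]
    simp_rw [h1]
    -- The localized noise vanishes off `A`, and `A` belongs to the history, so the conditional
    -- bound may be integrated over `A`.
    rw [lintegral_indicator hA0, ← setLIntegral_condLExp (ℱ.le t) P _ (hA t)]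
    calc ∫⁻ ω in A, P⁻[fun ω => ‖ξ (t + 1) ω‖ₑ ^ 2 | ℱ t] ω ∂P
        ≤ ∫⁻ ω in A, ENNReal.ofReal (σ ^ 2 * (1 + ‖θ t ω - θs‖ ^ 2)) ∂P :=
          lintegral_mono_ae (ae_restrict_of_ae (hσ t))
      _ = ∫⁻ ω in A, ENNReal.ofReal
            (σ ^ 2 * (1 + ‖A.piecewise (θ t) (fun _ => θs) ω - θs‖ ^ 2)) ∂P := by
          refine setLIntegral_congr_fun hA0 fun ω hω => ?_
          simp [hω]
      _ ≤ _ := setLIntegral_le_lintegral _ _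

/-- The accumulated noise of a stochastic approximation process converges almost surely, without any
integrability assumption on the initial value. -/
theorem ae_tendsto_accumulated_noise {L : ℝ≥0} (hL : LipschitzWith L f) (h0 : f θs = 0)
    {C T η : ℝ} (hC : 1 ≤ C) (hT : 0 < T) (hη : 0 < η) (hcon : EulerContracts f θs C T η)
    (hα : ∀ t, α t ∈ Set.Ioo (0 : ℝ) 1)
    (hθ0 : Measurable (θ 0)) (hξ : ∀ t, Measurable (ξ (t + 1))) (hrec : IsSARecursion f α θ ξ)
    (hN1 : NoiseMeanZero P θ ξ) (hN2 : NoiseVarianceBound P θs θ ξ)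
    (hs2 : Summable fun t => α t ^ 2) (hα0 : Tendsto α atTop (𝓝 0)) :
    ∀ᵐ ω ∂P, ∃ c, Tendsto (fun t => ∑ k ∈ Finset.range t, α k • ξ (k + 1) ω) atTop (𝓝 c) := by
  obtain ⟨σ, hσ⟩ := hN2
  have hloc := fun k : ℝ => isSquareIntegrableSA_localized (A := θ 0 ⁻¹' Metric.closedBall θs k)
    (k := k) (measurable_history_state le_rfl Metric.isClosed_closedBall.measurableSet)
    (fun ω hω => by simpa [dist_eq_norm] using hω) hL.continuous h0 hθ0 hξ hrec hN1 hσ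
  have hnoise : ∀ k : ℕ, ∀ᵐ ω ∂P, ∃ c, Tendsto (fun t => ∑ j ∈ Finset.range t,
      α j • (θ 0 ⁻¹' Metric.closedBall θs k).indicator (ξ (j + 1)) ω) atTop (𝓝 c) := fun k => by
    obtain ⟨R, hR⟩ : ∃ R, ∀ t, _ ≤ R := by
      by_cases hs1 : Summable α
      · exact (hloc k).exists_sq_le_of_summable hL h0 hα hs1
      · exact (hloc k).exists_sq_le_of_not_summable hL h0 hα hC hT hη hcon hs2
          ((not_summable_iff_tendsto_nat_atTop_of_nonneg fun t => (hα t).1.le).1 hs1) hα0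
    exact (hloc k).ae_tendsto_noise hL h0 hs2 hR
  filter_upwards [ae_all_iff.2 hnoise] with ω hω
  -- For this `k` the localized noise agrees with the original noise at `ω`.
  obtain ⟨k, hk⟩ := exists_nat_ge ‖θ 0 ω - θs‖
  simpa only [Set.indicator_of_mem (show ω ∈ θ 0 ⁻¹' Metric.closedBall θs k by
    simpa [dist_eq_norm] using hk)] using hω k

end StochApprox

/-! ### Conclusion -/

theorem mainTheorem3 {Ω : Type*} [MeasurableSpace Ω] (P : Measure Ω) [IsProbabilityMeasure P]
    (d : ℕ) (f : EuclideanSpace ℝ (Fin d) → EuclideanSpace ℝ (Fin d))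
    (θs : EuclideanSpace ℝ (Fin d))
    (α : ℕ → ℝ) (θ ξ : ℕ → Ω → EuclideanSpace ℝ (Fin d))
    (hα : ∀ t, α t ∈ Set.Ioo (0 : ℝ) 1)
    (hθ0 : Measurable (θ 0)) (hξ : ∀ t, Measurable (ξ (t + 1)))
    (hrec : StochApprox.IsSARecursion f α θ ξ)
    (hF1 : StochApprox.IsUniqueZero f θs)
    (hF2' : StochApprox.IsC2Lipschitz f)
    (hF3 : StochApprox.IsGloballyExpStable f θs)
    (hF4 : StochApprox.HasHessianDecay f θs)
    (hN1 : StochApprox.NoiseMeanZero P θ ξ)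
    (hN2 : StochApprox.NoiseVarianceBound P θs θ ξ) :
    (Summable (fun t => α t ^ 2) →
      ∀ᵐ ω ∂P, Bornology.IsBounded (Set.range fun t => θ t ω)) ∧
    (Summable (fun t => α t ^ 2) →
      Tendsto (fun n => ∑ t ∈ Finset.range n, α t) atTop atTop →
      ∀ᵐ ω ∂P, Tendsto (fun t => θ t ω) atTop (𝓝 θs)) := by
  obtain ⟨hC2, L, hL⟩ := hF2'
  obtain ⟨h0, μ, γ, hμ, hγ, hstab⟩ := hF3
  obtain ⟨C, T, η, hC, hT, hη, hcon⟩ := StochApprox.exists_euler_contraction hL h0 hμ hγ fun x => by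
    obtain ⟨s, hs0, hs⟩ :=
      StochApprox.exists_global_integralCurve (hC2.of_le one_le_two) hL x
    exact ⟨s, hs0, hs, hstab x s hs0 fun t _ => (hs t).hasDerivWithinAt⟩
  have hα0 : Summable (fun t => α t ^ 2) → Tendsto α atTop (𝓝 0) := fun hs2 => by
    have h1 := (Real.continuous_sqrt.tendsto 0).comp hs2.tendsto_atTop_zero
    rw [Real.sqrt_zero] at h1
    exact h1.congr fun t => Real.sqrt_sq (hα t).1.le
  have hpath : ∀ ω t, θ (t + 1) ω = θ t ω + α t • f (θ t ω) +
      (∑ k ∈ Finset.range (t + 1), α k • ξ (k + 1) ω - ∑ k ∈ Finset.range t, α k • ξ (k + 1) ω) :=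
    fun ω t => by
      rw [hrec t ω, Finset.sum_range_succ, add_sub_cancel_left, smul_add, add_assoc]
  have hnoise : Summable (fun t => α t ^ 2) → ∀ᵐ ω ∂P, ∃ c, Tendsto
      (fun t => ∑ k ∈ Finset.range t, α k • ξ (k + 1) ω) atTop (𝓝 c) := fun hs2 =>
    StochApprox.ae_tendsto_accumulated_noise hL h0 hC hT hη hcon hα hθ0 hξ
      hrec hN1 hN2 hs2 (hα0 hs2)
  have hconv : Summable (fun t => α t ^ 2) →
      Tendsto (fun n => ∑ t ∈ Finset.range n, α t) atTop atTop →
      ∀ᵐ ω ∂P, Tendsto (fun t => θ t ω) atTop (𝓝 θs) := fun hs2 hdiv => by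
    filter_upwards [hnoise hs2] with ω hω
    obtain ⟨c, hc⟩ := hω
    exact StochApprox.tendsto_of_tendsto_noise hL hC hT hη hcon hα (hα0 hs2) hdiv
      (M := fun t => ∑ k ∈ Finset.range t, α k • ξ (k + 1) ω) (hpath ω) hc
  refine ⟨fun hs2 => ?_, hconv⟩
  -- Boundedness comes from Grönwall for summable steps, and from convergence otherwise.
  by_cases hs1 : Summable α
  · filter_upwards [hnoise hs2] with ω hω
    obtain ⟨c, hc⟩ := hω
    exact StochApprox.isBounded_of_tendsto_noise hL h0 (fun t => (hα t).1.le) hs1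
      (M := fun t => ∑ k ∈ Finset.range t, α k • ξ (k + 1) ω) (hpath ω) hc
  · filter_upwards [hconv hs2
      ((not_summable_iff_tendsto_nat_atTop_of_nonneg fun t => (hα t).1.le).1 hs1)] with ω hω
    exact Metric.isBounded_range_of_tendsto _ hω
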